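/- **Theorem 3 (Achievability for Error Metric 2, linear regime).** Setting: let $\beta>2$, $\alpha\in(0,1)$, $\nu>0$, and for each $M$ put $L=L^{(M)}=\lfloor \frac1\beta M\rfloor$. For ${\bf x}\in\mathbb C^M$ let $\mathrm{supp}({\bf x})=\{i: x_i\ne 0\}$, $\mu({\bf x})=\min_{i\in\mathrm{supp}({\bf x})}|x_i|$ and $\|{\bf x}\|_2^2=\sum_i|x_i|^2$ (the total power). One observes ${\bf y}={\bf A}{\bf x}+{\bf n}\in\mathbb C^N$, where the $N\times M$ matrix ${\bf A}$ has i.i.d. circularly-symmetric complex Gaussian entries $\mathcal N_C(0,1)$ and ${\bf n}\sim\mathcal N_C(0,\nu^2I_N)$ is independent of ${\bf A}$. For $\delta>0$, an index set $\mathcal J\subset\{1,\dots,M\}$ with $|\mathcal J|=L$ is called $\delta$-jointly typical with ${\bf y}$ if the matrix ${\bf A}_{\mathcal J}$ of the columns of ${\bf A}$ with index in $\mathcal J$ has rank $L$ and $$\Big|\tfrac1N\|\Pi^{\perp}_{{\bf A}_{\mathcal J}}{\bf y}\|_2^2-\tfrac{N-L}{N}\nu^2\Big|<\delta,\qquad \Pi^\perp_{\bf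 B}=I-{\bf B}({\bf B}^*{\bf B})^{-1}{\bf B}^*.$$ A joint-typicality decoder with threshold $\delta$ is a measurable map $({\bf A},{\bf y})\mapsto\mathcal D({\bf y})\subset\{1,\dots,M\}$ which outputs a $\delta$-jointly typical set whenever there is one. An error (Error Metric 2) occurs unless $|\mathcal D({\bf y})\cap\mathrm{supp}({\bf x})|/|\mathrm{supp}({\bf x})|>1-\alpha$; $p_{\rm err}({\bf A}|{\bf x})$ denotes the probability of error over ${\bf n}$ for given ${\bf A}$, and $p_{\rm err}(\mathcal D|{\bf x})=\mathbb E_{\bf A}\,p_{\rm err}({\bf A}|{\bf x})$. Claim: for every $c>0$ there are constants $C_3>1$, $\delta>0$ and $r>0$, depending only on $\alpha$, $\beta$, $\nu$ and $c$, such that the following holds. Let $N=N(M)$ be natural numbers with $N(M)>C_3L^{(M)}$ for all sufficiently large $M$. Then joint-typicality decoders with threshold $\delta$ exist for all $M$. Moreover, for every choice of such decoders, every $P$ and every sequence ${\bf x}^{(M)}\in\mathbb C^M$ with $|\mathrm{supp}({\bf x}^{(M)})|=L^{(M)}$ for all $M$ and with $L^{(M)}\mu^2({\bf x}^{(M)})=c$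 and $\|{\bf x}^{(M)}\|_2^2=P$ for all sufficiently large $M$: 1. $p_{\rm err}(\mathcal D|{\bf x}^{(M)})\to0$ as $M\to\infty$; 2. in fact $p_{\rm err}(\mathcal D|{\bf x}^{(M)})\le e^{-rM}$ for all sufficiently large $M$; 3. for every $\xi\in(0,1]$, $\mathbb P\big(p_{\rm err}({\bf A}|{\bf x}^{(M)})>\xi\big)\le e^{-rM}$ for all sufficiently large $M$. -/

import Mathlib

open MeasureTheory ProbabilityTheory Filter Topology
open scoped ENNReal NNReal Matrix

namespace NoisyCS

noncomputable section

/-- The number of nonzero coefficients, `L = ⌊M / β⌋`. -/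
def sparsity (β : ℝ) (M : ℕ) : ℕ := ⌊(1 / β) * (M : ℝ)⌋₊

/-- The support of a complex vector. -/
def supp {M : ℕ} (x : Fin M → ℂ) : Finset (Fin M) := Finset.univ.filter fun i => x i ≠ 0

/-- The smallest modulus of an entry of `x` on its support. -/
def minMod {M : ℕ} (x : Fin M → ℂ) : ℝ := ⨅ i : supp x, ‖x i‖

/-- The total power (squared Euclidean norm) of a vector. -/
def power {M : ℕ} (x : Fin M → ℂ) : ℝ := ∑ i, ‖x i‖ ^ 2

/-- The circularly-symmetric complex Gaussian law with mean zero and variance `v`: real and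
imaginary part are independent real Gaussians with variance `v / 2`. -/
def complexGaussian (v : ℝ≥0) : Measure ℂ :=
  ((gaussianReal 0 (v / 2)).prod (gaussianReal 0 (v / 2))).map
    fun p : ℝ × ℝ => (p.1 : ℂ) + (p.2 : ℂ) * Complex.I

/-- The law of an `N × M` matrix with i.i.d. complex Gaussian entries of variance one. -/
def matrixLaw (N M : ℕ) : Measure (Fin N → Fin M → ℂ) :=
  Measure.pi fun _ => Measure.pi fun _ => complexGaussian 1

/-- The law of the noise vector, with i.i.d. complex Gaussian entries of variance `ν ^ 2`. -/
def noiseLaw (N : ℕ) (ν : ℝ) : Measure (Fin N → ℂ) :=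
  Measure.pi fun _ => complexGaussian (Real.toNNReal (ν ^ 2))

/-- The matrix formed by the columns of `A` with index in `J`. -/
def columns {N M : ℕ} (A : Fin N → Fin M → ℂ) (J : Finset (Fin M)) : Matrix (Fin N) J ℂ :=
  Matrix.of fun i j => A i j

/-- The matrix `I - B (B* B)⁻¹ B*`, which for `B` of full column rank is the orthogonal projection
onto the orthogonal complement of the column space of `B`. -/
def perpProj {N : ℕ} {κ : Type} [Fintype κ] [DecidableEq κ] (B : Matrix (Fin N) κ ℂ) :
    Matrix (Fin N) (Fin N) ℂ :=
  1 - B * (Bᴴ * B)⁻¹ * Bᴴ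

/-- The observation `y` and the index set `J` of size `L` are `δ`-jointly typical with respect to
the measurement matrix `A` and the noise level `ν`. -/
def JointlyTypical {N M : ℕ} (L : ℕ) (ν δ : ℝ) (A : Fin N → Fin M → ℂ) (y : Fin N → ℂ)
    (J : Finset (Fin M)) : Prop :=
  J.card = L ∧ (columns A J).rank = L ∧
    |1 / (N : ℝ) * power (perpProj (columns A J) *ᵥ y) - ((N : ℝ) - L) / N * ν ^ 2| < δ

/-- A decoder sees the measurement matrix and the observation and outputs a set of indices. -/
abbrev Decoder (N M : ℕ) : Type := (Fin N → Fin M → ℂ) → (Fin N → ℂ) → Finset (Fin M)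

/-- `D` is a (measurable) joint-typicality decoder with threshold `δ`: whenever some index set of
size `L` is `δ`-jointly typical with the observation, the output of `D` is such a set. -/
structure IsJointTypicalityDecoder {N M : ℕ} (L : ℕ) (ν δ : ℝ) (D : Decoder N M) : Prop where
  measurable : ∀ J : Finset (Fin M),
    MeasurableSet {p : (Fin N → Fin M → ℂ) × (Fin N → ℂ) | D p.1 p.2 = J}
  typical : ∀ A y, (∃ J, JointlyTypical L ν δ A y J) → JointlyTypical L ν δ A y (D A y)

/-- Success for the second error metric: the estimated support `J` contains more than a fraction
`1 - α` of the support of `x`. -/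
def Recovers {M : ℕ} (α : ℝ) (x : Fin M → ℂ) (J : Finset (Fin M)) : Prop :=
  ((J ∩ supp x).card : ℝ) / ((supp x).card : ℝ) > 1 - α

/-- The error probability `p_err(A | x)` over the noise for a fixed measurement matrix. -/
def errProb {N M : ℕ} (α ν : ℝ) (D : Decoder N M) (x : Fin M → ℂ) (A : Fin N → Fin M → ℂ) : ℝ≥0∞ :=
  noiseLaw N ν {n | ¬ Recovers α x (D A (Matrix.of A *ᵥ x + n))}

/-- The error probability `p_err(D | x)`, averaged over Gaussian measurement matrices. -/
def avgErrProb {N M : ℕ} (α ν : ℝ) (D : Decoder N M) (x : Fin M → ℂ) : ℝ≥0∞ :=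
  ∫⁻ A, errProb α ν D x A ∂(matrixLaw N M)

open scoped ComplexOrder in
lemma measurableSet_jointlyTypical {N M : ℕ} (L : ℕ) (ν δ : ℝ) (J : Finset (Fin M)) :
    MeasurableSet {p : (Fin N → Fin M → ℂ) × (Fin N → ℂ) | JointlyTypical L ν δ p.1 p.2 J} := by
  have hC : Continuous fun p : (Fin N → Fin M → ℂ) × (Fin N → ℂ) => columns p.1 J :=
    continuous_pi fun i => continuous_pi fun j => by
      change Continuous fun p : (Fin N → Fin M → ℂ) × (Fin N → ℂ) => p.1 i j
      fun_prop
  have hG : Continuous fun p : (Fin N → Fin M → ℂ) × (Fin N → ℂ) =>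
      (columns p.1 J)ᴴ * columns p.1 J := hC.matrix_conjTranspose.matrix_mul hC
  by_cases hJ : J.card = L
  swap
  · simp [JointlyTypical, hJ]
  have hr : MeasurableSet {p : (Fin N → Fin M → ℂ) × (Fin N → ℂ) | (columns p.1 J).rank = L} := by
    have : {p : (Fin N → Fin M → ℂ) × (Fin N → ℂ) | (columns p.1 J).rank = L} =
        {p | ((columns p.1 J)ᴴ * columns p.1 J).det = 0}ᶜ := by
      ext p
      simp only [Set.mem_ofPred_eq, Set.mem_compl_iff]
      rw [← Matrix.rank_conjTranspose_mul_self, ← ne_eq, ← isUnit_iff_ne_zero,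
        ← Matrix.isUnit_iff_isUnit_det]
      constructor
      · intro h
        rw [← Matrix.linearIndependent_cols_iff_isUnit, linearIndependent_iff_card_eq_finrank_span,
          Set.finrank, ← Matrix.rank_eq_finrank_span_cols, h]
        simp [hJ]
      · intro h
        rw [Matrix.rank_of_isUnit _ h]
        simp [hJ]
    rw [this]
    exact (isClosed_eq hG.matrix_det continuous_const).measurableSet.compl
  have hm : Measurable fun p : (Fin N → Fin M → ℂ) × (Fin N → ℂ) =>
      power (perpProj (columns p.1 J) *ᵥ p.2) := by
    have hinv : ∀ a b, Measurable fun p : (Fin N → Fin M → ℂ) × (Fin N → ℂ) =>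
        (((columns p.1 J)ᴴ * columns p.1 J)⁻¹) a b := by
      intro a b
      simp only [Matrix.inv_def, Matrix.smul_apply, smul_eq_mul, Ring.inverse_eq_inv']
      exact hG.matrix_det.measurable.inv.mul (hG.matrix_adjugate.matrix_elem a b).measurable
    have hC' : ∀ i j, Measurable fun p : (Fin N → Fin M → ℂ) × (Fin N → ℂ) =>
        columns p.1 J i j := fun i j => (hC.matrix_elem i j).measurable
    have hCs : ∀ i j, Measurable fun p : (Fin N → Fin M → ℂ) × (Fin N → ℂ) =>
        (columns p.1 J)ᴴ i j := fun i j => (hC.matrix_conjTranspose.matrix_elem i j).measurable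
    have hy : ∀ i, Measurable fun p : (Fin N → Fin M → ℂ) × (Fin N → ℂ) => p.2 i :=
      fun i => by fun_prop
    have hP : ∀ i k, Measurable fun p : (Fin N → Fin M → ℂ) × (Fin N → ℂ) =>
        perpProj (columns p.1 J) i k := by
      intro i k
      simp only [perpProj, Matrix.sub_apply, Matrix.mul_apply]
      refine measurable_const.sub (Finset.measurable_sum _ fun j _ => Measurable.mul ?_ (hCs j k))
      exact Finset.measurable_sum _ fun l _ => (hC' i l).mul (hinv l j)
    simp only [power, Matrix.mulVec, dotProduct]
    exact Finset.measurable_sum _ fun i _ =>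
      ((Finset.measurable_sum _ fun k _ => (hP i k).mul (hy k)).norm.pow_const 2)
  have hlt : MeasurableSet {p : (Fin N → Fin M → ℂ) × (Fin N → ℂ) |
      |1 / (N : ℝ) * power (perpProj (columns p.1 J) *ᵥ p.2) - ((N : ℝ) - L) / N * ν ^ 2| < δ} :=
    measurableSet_lt (measurable_norm.comp ((hm.const_mul _).sub_const _)) measurable_const
  have : {p : (Fin N → Fin M → ℂ) × (Fin N → ℂ) | JointlyTypical L ν δ p.1 p.2 J} =
      {p | (columns p.1 J).rank = L} ∩ {p |
      |1 / (N : ℝ) * power (perpProj (columns p.1 J) *ᵥ p.2) - ((N : ℝ) - L) / N * ν ^ 2| < δ} := by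
    ext p
    simp [JointlyTypical, hJ]
  rw [this]
  exact hr.inter hlt

/-- Joint-typicality decoders exist, for all parameters. -/
lemma exists_isJointTypicalityDecoder (N M L : ℕ) (ν δ : ℝ) :
    ∃ D : Decoder N M, IsJointTypicalityDecoder L ν δ D := by
  classical
  let F : (Finset (Fin M) → Prop) → Finset (Fin M) := fun T =>
    if h : ∃ J, T J then h.choose else ∅
  refine ⟨fun A y => F (JointlyTypical L ν δ A y), ⟨fun J => ?_, fun A y h => ?_⟩⟩
  · have hT : Measurable fun p : (Fin N → Fin M → ℂ) × (Fin N → ℂ) =>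
        (JointlyTypical L ν δ p.1 p.2) :=
      measurable_pi_iff.2 fun K => measurableSet_setOfPred.1 (measurableSet_jointlyTypical L ν δ K)
    exact hT (Set.toFinite (F ⁻¹' {J})).measurableSet
  · simp only [F, dif_pos h]
    exact h.choose_spec

end

end NoisyCS

namespace NoisyCS

/-! ### Complex Gaussian vectors -/

/-! Projecting `y = A x + n` away from the columns in `J` kills the part of `x` supported in `J`.
The remaining columns and the noise are independent of `A_J`, so by unitary invariance the residual
has the power of a Gaussian vector of length `N - |J|`, with variance `ν ^ 2` plus the power of `x`
outside `J` (`measure_residual_le`). For `J = supp x` the variance is `ν ^ 2`. A set that fails to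
recover misses at least `α L` support entries, each of squared modulus at least `c / L`, so the
variance is at least `ν ^ 2 + α c`, a gap that does not depend on `M`
(`le_sum_restrictCompl_of_not_recovers`).

The decoder can therefore fail only if `A` is rank deficient on the support (a null event,
`ae_rank_columns`), if the residual of the true support deviates from its mean, or if the residual
of some non-recovering set is too small (`errorEvent_subset`). The Chernoff bound
`measure_power_tail` makes each deviation exponentially unlikely in `N - L`, and there are at most
`2 ^ M` wrong sets (`avgErrProb_le`). As `L` is proportional to `M`, a large `C₃` makes the exponent
beat this count. Markov's inequality then gives the bound for typical matrices. -/

instance isProbabilityMeasure_complexGaussian (v : ℝ≥0) :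
    IsProbabilityMeasure (complexGaussian v) :=
  Measure.isProbabilityMeasure_map (by fun_prop)

instance isProbabilityMeasure_matrixLaw (N M : ℕ) : IsProbabilityMeasure (matrixLaw N M) := by
  unfold matrixLaw; infer_instance

instance isProbabilityMeasure_noiseLaw (N : ℕ) (ν : ℝ) : IsProbabilityMeasure (noiseLaw N ν) := by
  unfold noiseLaw; infer_instance

lemma charFunDual_gaussianReal_zero (v : ℝ≥0) (ℓ : StrongDual ℝ ℝ) :
    charFunDual (gaussianReal 0 v) ℓ = Complex.exp (-(v * (ℓ 1 : ℂ) ^ 2 / 2)) := by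
  have h : charFunDual (gaussianReal 0 v) ℓ = charFun (gaussianReal 0 v) (ℓ 1) := by
    rw [charFunDual_apply, charFun_apply_real]
    congr with x
    have : ℓ x = x * ℓ 1 := by
      conv_lhs => rw [← mul_one x, ← smul_eq_mul, map_smul, smul_eq_mul]
    rw [this]
    push_cast
    ring_nf
  rw [h, charFun_gaussianReal]
  simp

lemma charFunDual_complexGaussian (v : ℝ≥0) (ℓ : StrongDual ℝ ℂ) :
    charFunDual (complexGaussian v) ℓ =
      Complex.exp (-((v : ℂ) / 4 * (((ℓ 1) ^ 2 + (ℓ Complex.I) ^ 2 : ℝ) : ℂ))) := by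
  have h : complexGaussian v = ((gaussianReal 0 (v / 2)).prod (gaussianReal 0 (v / 2))).map
      (Complex.equivRealProdCLM.symm : ℝ × ℝ →L[ℝ] ℂ) := by
    unfold complexGaussian
    congr 1
    ext p
    exact (Complex.equivRealProd_symm_apply p).symm
  rw [h, charFunDual_map, charFunDual_prod, charFunDual_gaussianReal_zero,
    charFunDual_gaussianReal_zero, ← Complex.exp_add]
  have h1 : Complex.equivRealProdCLM.symm ((1 : ℝ), (0 : ℝ)) = 1 := by
    simp [Complex.equivRealProdCLM_symm_apply]
  have h2 : Complex.equivRealProdCLM.symm ((0 : ℝ), (1 : ℝ)) = Complex.I := by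
    simp [Complex.equivRealProdCLM_symm_apply]
  simp [h1, h2]
  ring_nf

/-- The characteristic function of a vector of i.i.d. complex Gaussian variables, at the functional
`w ↦ Re (t ⬝ᵥ w)`. -/
lemma charFunDual_pi_complexGaussian {κ : Type*} [Fintype κ] (v : ℝ≥0)
    (ℓ : StrongDual ℝ (κ → ℂ)) (t : κ → ℂ) (h : ∀ w, ℓ w = (t ⬝ᵥ w).re) :
    charFunDual (Measure.pi fun _ : κ => complexGaussian v) ℓ =
      Complex.exp (-((v : ℂ) / 4 * ((∑ k, ‖t k‖ ^ 2 : ℝ) : ℂ))) := by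
  classical
  rw [charFunDual_pi]
  simp_rw [charFunDual_complexGaussian]
  rw [← Complex.exp_sum, Finset.sum_neg_distrib, ← Finset.mul_sum]
  congr 3
  rw [← Complex.ofReal_sum]
  congr 1
  refine Finset.sum_congr rfl fun k _ => ?_
  have h1 : (ℓ.comp (.single ℝ (fun _ => ℂ) k)) 1 = (t k).re := by
    simp [h]
  have h2 : (ℓ.comp (.single ℝ (fun _ => ℂ) k)) Complex.I = - (t k).im := by
    simp [h]
  rw [h1, h2, Complex.sq_norm, Complex.normSq_apply]
  ring

/-- Reduces the comparison of laws on `κ → ℂ` to characteristic functions at a complex vector `t`,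
on which matrices act by transposition. -/
lemma exists_strongDual_eq_re_dotProduct {κ : Type*} [Fintype κ] (ℓ : StrongDual ℝ (κ → ℂ)) :
    ∃ t : κ → ℂ, ∀ w, ℓ w = (t ⬝ᵥ w).re := by
  classical
  refine ⟨fun k => ⟨ℓ (Pi.single k 1), -ℓ (Pi.single k Complex.I)⟩, fun w => ?_⟩
  have hw : w = ∑ k, ((w k).re • (Pi.single k (1 : ℂ) : κ → ℂ) +
      (w k).im • (Pi.single k Complex.I : κ → ℂ)) := by
    ext k
    simp [Finset.sum_apply, Pi.single_apply, Finset.sum_add_distrib, Complex.re_add_im]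
  conv_lhs => rw [hw]
  simp [dotProduct, Complex.mul_re, mul_comm]

lemma ofReal_sum_norm_sq {κ : Type*} [Fintype κ] (s : κ → ℂ) :
    ((∑ k, ‖s k‖ ^ 2 : ℝ) : ℂ) = s ⬝ᵥ star s := by
  simp [dotProduct, Complex.mul_conj']

/-- The image of a vector of i.i.d. complex Gaussian variables under a matrix with orthogonal rows
of equal norm consists of i.i.d. complex Gaussian variables. -/
lemma map_mulVec_pi_complexGaussian {κ ι : Type*} [Fintype κ] [Fintype ι] [DecidableEq κ]
    (T : Matrix κ ι ℂ) (u v : ℝ≥0) (hT : T * Tᴴ = ((u : ℝ) : ℂ) • (1 : Matrix κ κ ℂ)) :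
    (Measure.pi fun _ : ι => complexGaussian v).map (fun w => T *ᵥ w) =
      Measure.pi fun _ : κ => complexGaussian (u * v) := by
  let Λ : (ι → ℂ) →L[ℝ] (κ → ℂ) := (T.mulVecLin.restrictScalars ℝ).toContinuousLinearMap
  have hΛ : (fun w => T *ᵥ w) = Λ := by ext w; simp [Λ]
  have : IsProbabilityMeasure ((Measure.pi fun _ : ι => complexGaussian v).map Λ) :=
    Measure.isProbabilityMeasure_map (by fun_prop)
  rw [hΛ]
  refine Measure.ext_of_charFunDual (funext fun ℓ => ?_)
  obtain ⟨t, ht⟩ := exists_strongDual_eq_re_dotProduct ℓ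
  rw [charFunDual_map, charFunDual_pi_complexGaussian (u * v) ℓ t ht,
    charFunDual_pi_complexGaussian v (ℓ.comp Λ) (t ᵥ* T) fun w => by
      rw [ContinuousLinearMap.comp_apply, ht, ← hΛ, Matrix.dotProduct_mulVec]]
  -- The characteristic function sees `t` only through its norm, and `T * Tᴴ = u • 1` says that `t ↦
  -- t ᵥ* T` scales squared norms by `u`.
  have key : ((∑ i, ‖(t ᵥ* T) i‖ ^ 2 : ℝ) : ℂ) = (u : ℝ) * ((∑ k, ‖t k‖ ^ 2 : ℝ) : ℂ) := by
    rw [ofReal_sum_norm_sq, ofReal_sum_norm_sq, Matrix.star_vecMul, ← Matrix.dotProduct_mulVec, Matrix.mulVec_mulVec, hT,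
      Matrix.smul_mulVec, Matrix.one_mulVec, dotProduct_smul, smul_eq_mul]
  rw [key]
  congr 2
  push_cast
  ring

lemma map_dotProduct_pi_complexGaussian {ι : Type*} [Fintype ι] (x : ι → ℂ) :
    (Measure.pi fun _ : ι => complexGaussian 1).map (fun a => a ⬝ᵥ x) =
      complexGaussian (∑ i, ‖x i‖₊ ^ 2) := by
  have h := map_mulVec_pi_complexGaussian (Matrix.of fun (_ : Unit) i => x i)
    (∑ i, ‖x i‖₊ ^ 2) 1 (by
      ext i j
      simp [Matrix.mul_apply, Complex.mul_conj'])
  have h2 := congrArg (Measure.map fun f : Unit → ℂ => f ()) h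
  rw [Measure.map_map (by fun_prop) (by fun_prop),
    (measurePreserving_eval (fun _ : Unit => complexGaussian _) ()).map_eq, mul_one] at h2
  rw [← h2]
  congr 1
  ext a
  simp [Matrix.mulVec, dotProduct_comm]

lemma map_mulVec_matrixLaw {N M : ℕ} (x : Fin M → ℂ) :
    (matrixLaw N M).map (fun A => Matrix.of A *ᵥ x) =
      Measure.pi fun _ => complexGaussian (∑ i, ‖x i‖₊ ^ 2) := by
  unfold matrixLaw
  simp_rw [← map_dotProduct_pi_complexGaussian x]
  have hx : Measurable fun a : Fin M → ℂ => a ⬝ᵥ x :=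
    Finset.measurable_sum _ fun i _ => (measurable_pi_apply i).mul_const _
  have : IsProbabilityMeasure
      ((Measure.pi fun _ : Fin M => complexGaussian 1).map fun a => a ⬝ᵥ x) :=
    Measure.isProbabilityMeasure_map hx.aemeasurable
  exact Measure.pi_map_pi (f := fun _ : Fin N => fun a : Fin M → ℂ => a ⬝ᵥ x)
    fun _ => hx.aemeasurable

lemma map_add_pi_complexGaussian {κ : Type*} [Fintype κ] (u v : ℝ≥0) :
    ((Measure.pi fun _ : κ => complexGaussian u).prod
      (Measure.pi fun _ : κ => complexGaussian v)).map (fun p => p.1 + p.2) =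
      Measure.pi fun _ : κ => complexGaussian (u + v) := by
  change (Measure.pi fun _ : κ => complexGaussian u) ∗ (Measure.pi fun _ : κ => complexGaussian v)
    = _
  refine Measure.ext_of_charFunDual (funext fun ℓ => ?_)
  obtain ⟨t, ht⟩ := exists_strongDual_eq_re_dotProduct ℓ
  rw [charFunDual_conv, charFunDual_pi_complexGaussian _ ℓ t ht,
    charFunDual_pi_complexGaussian _ ℓ t ht, charFunDual_pi_complexGaussian _ ℓ t ht,
    ← Complex.exp_add]
  push_cast
  ring_nf

/-- Selecting each coordinate from one of two independent copies of a random vector with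
independent coordinates does not change the law. -/
lemma map_pi_ite_prod_pi {ι E : Type*} [Fintype ι] [MeasurableSpace E]
    (μ : ι → Measure E) [∀ i, IsProbabilityMeasure (μ i)] (f : ι → E × E → E)
    (hf : ∀ i, MeasurePreserving (f i) ((μ i).prod (μ i)) (μ i)) :
    MeasurePreserving (fun (p : (ι → E) × (ι → E)) i => f i (p.1 i, p.2 i))
      ((Measure.pi μ).prod (Measure.pi μ)) (Measure.pi μ) := by
  have h := (measurePreserving_arrowProdEquivProdArrow E E ι μ μ).symm
  have h2 : MeasurePreserving (fun (p : ι → E × E) i => f i (p i))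
      (Measure.pi fun i => (μ i).prod (μ i)) (Measure.pi μ) := by
    have (i : ι) : IsProbabilityMeasure (((μ i).prod (μ i)).map (f i)) :=
      Measure.isProbabilityMeasure_map (hf i).measurable.aemeasurable
    refine ⟨measurable_pi_lambda _ fun i => (hf i).measurable.comp (measurable_pi_apply i), ?_⟩
    rw [Measure.pi_map_pi fun i => (hf i).measurable.aemeasurable]
    simp_rw [fun i => (hf i).map_eq]
  exact h2.comp h

/-- The matrix with the columns of `A` at indices in `J` and those of `A'` elsewhere. -/
def mixColumns {N M : ℕ} (J : Finset (Fin M))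
    (p : (Fin N → Fin M → ℂ) × (Fin N → Fin M → ℂ)) : Fin N → Fin M → ℂ :=
  fun i j => if j ∈ J then p.1 i j else p.2 i j

/-- Expresses the independence of the columns in `J` from the others: the matrix may be drawn as a
mixture of two independent copies, one of which can then be held fixed. -/
lemma measurePreserving_mixColumns {N M : ℕ} (J : Finset (Fin M)) :
    MeasurePreserving (mixColumns (N := N) J) ((matrixLaw N M).prod (matrixLaw N M))
      (matrixLaw N M) := by
  refine map_pi_ite_prod_pi _ (fun _ (q : (Fin M → ℂ) × (Fin M → ℂ)) j => if j ∈ J then q.1 j else q.2 j) fun i => ?_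
  refine map_pi_ite_prod_pi _ (fun j (q : ℂ × ℂ) => if j ∈ J then q.1 else q.2) fun j => ?_
  by_cases hj : j ∈ J
  · simpa [hj] using measurePreserving_fst
  · simpa [hj] using measurePreserving_snd

/-! ### Large deviations of the power of a complex Gaussian vector -/

lemma lintegral_exp_mul_sq_gaussianReal {v : ℝ≥0} (hv : v ≠ 0) {s : ℝ} (hs : 2 * s * v < 1) :
    ∫⁻ x, ENNReal.ofReal (Real.exp (s * x ^ 2)) ∂(gaussianReal 0 v) =
      ENNReal.ofReal (√(1 - 2 * s * v))⁻¹ := by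
  have hv' : (0 : ℝ) < v := by positivity
  -- The density times `exp (s x ^ 2)` is again a Gaussian profile; its exponent is negative exactly
  -- because `2 s v < 1`.
  have hb : 0 < (1 - 2 * s * v) / (2 * v) := div_pos (by linarith) (by positivity)
  have hfun : (fun x => gaussianPDFReal 0 v x * Real.exp (s * x ^ 2)) =
      fun x => (√(2 * Real.pi * v))⁻¹ * Real.exp (-((1 - 2 * s * v) / (2 * v)) * x ^ 2) := by
    ext x
    rw [gaussianPDFReal, mul_assoc, ← Real.exp_add]
    congr 2
    field_simp
    ring
  rw [gaussianReal_of_var_ne_zero _ hv,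
    lintegral_withDensity_eq_lintegral_mul _ (measurable_gaussianPDF 0 v) (by fun_prop)]
  simp only [Pi.mul_apply, gaussianPDF]
  simp_rw [← ENNReal.ofReal_mul (gaussianPDFReal_nonneg 0 v _), congrFun hfun]
  rw [← ofReal_integral_eq_lintegral_ofReal ((integrable_exp_neg_mul_sq hb).const_mul _)
    (.of_forall fun x => by positivity), integral_const_mul, integral_gaussian]
  congr 1
  rw [← Real.sqrt_inv, ← Real.sqrt_inv, ← Real.sqrt_mul (by positivity)]
  congr 1
  have : 1 - 2 * s * v ≠ 0 := by linarith
  field_simp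

lemma lintegral_exp_mul_norm_sq_complexGaussian {v : ℝ≥0} (hv : v ≠ 0) {s : ℝ} (hs : s * v < 1) :
    ∫⁻ z, ENNReal.ofReal (Real.exp (s * ‖z‖ ^ 2)) ∂(complexGaussian v) =
      ENNReal.ofReal (1 - s * v)⁻¹ := by
  have hv2 : v / 2 ≠ 0 := by simpa using hv
  have hs2 : 2 * s * ((v / 2 : ℝ≥0) : ℝ) < 1 := by
    push_cast; linarith
  have e : ∀ p : ℝ × ℝ, ENNReal.ofReal
      (Real.exp (s * ‖(p.1 : ℂ) + (p.2 : ℂ) * Complex.I‖ ^ 2)) =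
      ENNReal.ofReal (Real.exp (s * p.1 ^ 2)) * ENNReal.ofReal (Real.exp (s * p.2 ^ 2)) := by
    intro p
    rw [← ENNReal.ofReal_mul (by positivity), ← Real.exp_add, Complex.sq_norm,
      Complex.normSq_add_mul_I]
    ring_nf
  rw [complexGaussian, lintegral_map (by fun_prop) (by fun_prop)]
  simp_rw [e]
  rw [lintegral_prod_mul (f := fun x : ℝ => ENNReal.ofReal (Real.exp (s * x ^ 2)))
    (g := fun x : ℝ => ENNReal.ofReal (Real.exp (s * x ^ 2))) (by fun_prop) (by fun_prop),
    lintegral_exp_mul_sq_gaussianReal hv2 hs2,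
    ← ENNReal.ofReal_mul (by positivity), ← mul_inv, Real.mul_self_sqrt (by linarith)]
  congr 2
  push_cast
  ring

lemma lintegral_exp_mul_sum_pi_complexGaussian {κ : Type*} [Fintype κ] {v : ℝ≥0} (hv : v ≠ 0)
    {s : ℝ} (hs : s * v < 1) :
    ∫⁻ w, ENNReal.ofReal (Real.exp (s * ∑ k, ‖w k‖ ^ 2))
        ∂(Measure.pi fun _ : κ => complexGaussian v) =
      ENNReal.ofReal (1 - s * v)⁻¹ ^ Fintype.card κ := by
  have hind : iIndepFun (fun (k : κ) (w : κ → ℂ) => ENNReal.ofReal (Real.exp (s * ‖w k‖ ^ 2)))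
      (Measure.pi fun _ : κ => complexGaussian v) :=
    iIndepFun_pi (X := fun _ z => ENNReal.ofReal (Real.exp (s * ‖z‖ ^ 2)))
      fun _ => by fun_prop
  have h := lintegral_prod_eq_prod_lintegral_of_indepFun Finset.univ _ hind fun k => by fun_prop
  simp_rw [Finset.mul_sum, Real.exp_sum,
    ENNReal.ofReal_prod_of_nonneg fun k _ => (Real.exp_pos _).le]
  rw [h]
  have hk : ∀ k : κ, ∫⁻ w, ENNReal.ofReal (Real.exp (s * ‖w k‖ ^ 2))
      ∂(Measure.pi fun _ : κ => complexGaussian v) = ENNReal.ofReal (1 - s * v)⁻¹ := by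
    intro k
    rw [← lintegral_exp_mul_norm_sq_complexGaussian hv hs]
    exact (measurePreserving_eval (fun _ : κ => complexGaussian v) k).lintegral_comp
      (f := fun z => ENNReal.ofReal (Real.exp (s * ‖z‖ ^ 2))) (by fun_prop)
  simp [hk]

/-- The rate function of the exponential distribution of mean one. -/
noncomputable def expRate (θ : ℝ) : ℝ := θ - 1 - Real.log θ

lemma expRate_pos {θ : ℝ} (h0 : 0 < θ) (h1 : θ ≠ 1) : 0 < expRate θ := by
  have := Real.log_lt_sub_one_of_pos h0 h1
  unfold expRate
  linarith

/-- Chernoff bound for the power of a complex Gaussian vector, for both tails at once. -/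
lemma measure_power_tail {q : ℕ} {v : ℝ≥0} (hv : v ≠ 0) {θ : ℝ} (h0 : 0 < θ)
    {S : Set (Fin q → ℂ)} (hS : ∀ w ∈ S, (1 - θ⁻¹) * (q * θ * v) ≤ (1 - θ⁻¹) * power w) :
    (Measure.pi fun _ : Fin q => complexGaussian v) S ≤
      ENNReal.ofReal (Real.exp (-(q * expRate θ))) := by
  have hv' : (0 : ℝ) < v := by positivity
  -- The optimal Chernoff tilt for the level `q θ v`: it turns the factor `(1 - s v)⁻¹` into `θ`.
  -- Its sign is that of `θ - 1`, which is why the weight `1 - θ⁻¹` in `hS` selects the lower or the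
  -- upper tail.
  set s : ℝ := (1 - θ⁻¹) / v with hs
  have hsv : s * v = 1 - θ⁻¹ := by rw [hs]; field_simp
  have hθ : 0 < θ⁻¹ := inv_pos.2 h0
  have hI := lintegral_exp_mul_sum_pi_complexGaussian (κ := Fin q) hv (s := s) (by linarith)
  have hval : (1 - s * v)⁻¹ = θ := by rw [hsv]; simp
  rw [hval, Fintype.card_fin, ← ENNReal.ofReal_pow h0.le] at hI
  set a : ℝ := q * (θ - 1)
  have hsub : S ⊆ {w | ENNReal.ofReal (Real.exp a) ≤
      ENNReal.ofReal (Real.exp (s * ∑ k, ‖w k‖ ^ 2))} := by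
    intro w hw
    refine ENNReal.ofReal_le_ofReal (Real.exp_le_exp.2 ?_)
    have h1 := div_le_div_of_nonneg_right (hS w hw) hv'.le
    have h2 : (1 - θ⁻¹) * (q * θ * v) / v = a := by
      simp only [a]; field_simp
    rw [h2] at h1
    calc a ≤ _ := h1
      _ = _ := by rw [hs, power]; ring
  have hM := meas_ge_le_lintegral_div (μ := Measure.pi fun _ : Fin q => complexGaussian v)
    (f := fun w => ENNReal.ofReal (Real.exp (s * ∑ k, ‖w k‖ ^ 2)))
    (Measurable.aemeasurable (by fun_prop)) (ε := ENNReal.ofReal (Real.exp a)) (by simp [Real.exp_pos]) ENNReal.ofReal_ne_top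
  refine (measure_mono hsub).trans (hM.trans ?_)
  rw [hI, ← ENNReal.ofReal_div_of_pos (Real.exp_pos _)]
  refine ENNReal.ofReal_le_ofReal (le_of_eq ?_)
  rw [← Real.exp_log h0, ← Real.exp_nat_mul, ← Real.exp_sub, Real.exp_log h0]
  simp only [a, expRate]
  ring_nf

/-! ### The projection onto the orthogonal complement of the column space -/

section perpProj

variable {N : ℕ} {κ : Type} [Fintype κ] [DecidableEq κ] {B : Matrix (Fin N) κ ℂ}

open scoped ComplexOrder in
lemma isUnit_conjTranspose_mul_self (hB : B.rank = Fintype.card κ) : IsUnit (Bᴴ * B) := by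
  rw [← Matrix.linearIndependent_cols_iff_isUnit, linearIndependent_iff_card_eq_finrank_span,
    Set.finrank, ← Matrix.rank_eq_finrank_span_cols, Matrix.rank_conjTranspose_mul_self, hB]

lemma perpProj_mul_self (hB : B.rank = Fintype.card κ) : perpProj B * B = 0 := by
  have h := (Matrix.isUnit_iff_isUnit_det _).1 (isUnit_conjTranspose_mul_self hB)
  rw [perpProj, Matrix.sub_mul, Matrix.one_mul, Matrix.mul_assoc, Matrix.mul_assoc,
    Matrix.nonsing_inv_mul _ h, Matrix.mul_one, sub_self]

lemma perpProj_mul_perpProj (hB : B.rank = Fintype.card κ) :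
    perpProj B * perpProj B = perpProj B := by
  change perpProj B * (1 - B * (Bᴴ * B)⁻¹ * Bᴴ) = _
  rw [Matrix.mul_sub, Matrix.mul_one, Matrix.mul_assoc B, ← Matrix.mul_assoc _ B,
    perpProj_mul_self hB, Matrix.zero_mul, sub_zero]

lemma conjTranspose_perpProj : (perpProj B)ᴴ = perpProj B := by
  simp [perpProj, Matrix.conjTranspose_mul, Matrix.conjTranspose_nonsing_inv, Matrix.mul_assoc]

lemma trace_perpProj (hB : B.rank = Fintype.card κ) :
    (perpProj B).trace = (N : ℂ) - Fintype.card κ := by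
  have h := (Matrix.isUnit_iff_isUnit_det _).1 (isUnit_conjTranspose_mul_self hB)
  rw [perpProj, Matrix.trace_sub, Matrix.trace_mul_comm, ← Matrix.mul_assoc,
    Matrix.mul_nonsing_inv _ h]
  simp

/-- A Hermitian idempotent matrix factors through the coordinates with respect to an orthonormal
basis of its range. -/
lemma exists_conjTranspose_mul_eq_of_idempotent {P : Matrix (Fin N) (Fin N) ℂ} (hP : P * P = P)
    (hP' : Pᴴ = P) :
    ∃ (q : ℕ) (U : Matrix (Fin q) (Fin N) ℂ), U * Uᴴ = 1 ∧ Uᴴ * U = P := by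
  -- For an idempotent the range is the space of fixed vectors.
  let S : Submodule ℂ (EuclideanSpace ℂ (Fin N)) :=
    { carrier := {w | P *ᵥ w.ofLp = w.ofLp}
      add_mem' := fun {a b} ha hb => by
        simp only [Set.mem_ofPred_eq] at ha hb ⊢
        simp [Matrix.mulVec_add, ha, hb]
      zero_mem' := by simp
      smul_mem' := fun c a ha => by
        simp only [Set.mem_ofPred_eq] at ha ⊢
        simp [Matrix.mulVec_smul, ha] }
  let b := stdOrthonormalBasis ℂ S
  let U : Matrix (Fin (Module.finrank ℂ S)) (Fin N) ℂ :=
    Matrix.of fun k i => star ((b k : EuclideanSpace ℂ (Fin N)).ofLp i)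
  have hPU : P * Uᴴ = Uᴴ := by
    ext i k
    have h : P *ᵥ (b k : EuclideanSpace ℂ (Fin N)).ofLp = (b k : EuclideanSpace ℂ (Fin N)).ofLp :=
      (b k).2
    simpa [U, Matrix.mul_apply, Matrix.mulVec, dotProduct] using congrFun h i
  have hUP : (Uᴴ * U) * P = P := by
    refine Matrix.ext_of_mulVec_single fun j => ?_
    rw [← Matrix.mulVec_mulVec]
    set w : Fin N → ℂ := P *ᵥ Pi.single j 1 with hw
    have hwS : WithLp.toLp 2 w ∈ S := by
      change P *ᵥ w = w
      rw [hw, Matrix.mulVec_mulVec, hP]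
    have h := congrArg (fun y : S => (y : EuclideanSpace ℂ (Fin N)).ofLp)
      (b.sum_repr' ⟨WithLp.toLp 2 w, hwS⟩)
    ext i
    have hi := congrFun h i
    simp only [Submodule.coe_sum, Submodule.coe_smul, WithLp.ofLp_sum, WithLp.ofLp_smul,
      Finset.sum_apply, Pi.smul_apply, smul_eq_mul, Submodule.coe_inner] at hi
    rw [← hi, ← Matrix.mulVec_mulVec]
    simp only [Matrix.mulVec, dotProduct, Matrix.conjTranspose_apply, U, Matrix.of_apply,
      star_star, PiLp.inner_apply, RCLike.inner_apply]
    refine Finset.sum_congr rfl fun k _ => ?_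
    rw [mul_comm]
    congr 1
    exact Finset.sum_congr rfl fun l _ => mul_comm _ _
  refine ⟨_, U, ?_, ?_⟩
  · ext k l
    have h := orthonormal_iff_ite.1 b.orthonormal k l
    rw [Submodule.coe_inner, PiLp.inner_apply] at h
    simp only [Matrix.mul_apply, Matrix.conjTranspose_apply, U, Matrix.of_apply, star_star,
      Matrix.one_apply]
    rw [← h]
    exact Finset.sum_congr rfl fun i _ => by rw [RCLike.inner_apply, mul_comm]; rfl
  · have h1 : (Uᴴ * U) * P = Uᴴ * U := by
      have := congrArg Matrix.conjTranspose (congrArg (· * U) hPU)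
      simpa [Matrix.conjTranspose_mul, hP', Matrix.mul_assoc] using this
    rw [← h1, hUP]

lemma exists_conjTranspose_mul_eq_perpProj (hB : B.rank = Fintype.card κ) {d : ℕ}
    (hd : Fintype.card κ = d) :
    ∃ U : Matrix (Fin (N - d)) (Fin N) ℂ, U * Uᴴ = 1 ∧ Uᴴ * U = perpProj B := by
  obtain ⟨q, U, h1, h2⟩ := exists_conjTranspose_mul_eq_of_idempotent (perpProj_mul_perpProj hB)
    (conjTranspose_perpProj (B := B))
  -- Both `q` and `N - d` are the trace of the projection, so `U` has exactly `N - d` rows.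
  have hq : (q : ℂ) = (N : ℂ) - Fintype.card κ := by
    rw [← trace_perpProj hB, ← h2, Matrix.trace_mul_comm, h1]
    simp
  have hq' : q + Fintype.card κ = N := by
    have : ((q + Fintype.card κ : ℕ) : ℂ) = N := by push_cast; rw [hq]; ring
    exact_mod_cast this
  obtain rfl : q = N - d := by omega
  exact ⟨U, h1, h2⟩

/-- Both powers are the quadratic form of `P` at `w`, since `Pᴴ * P = P = Uᴴ * U`. -/
lemma power_eq_of_conjTranspose_mul {m : ℕ} {U : Matrix (Fin m) (Fin N) ℂ}
    {P : Matrix (Fin N) (Fin N) ℂ} (hP : P * P = P) (hP' : Pᴴ = P) (hU : Uᴴ * U = P)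
    (w : Fin N → ℂ) : power (P *ᵥ w) = power (U *ᵥ w) := by
  have h (n : ℕ) (T : Matrix (Fin n) (Fin N) ℂ) :
      ((power (T *ᵥ w) : ℝ) : ℂ) = w ⬝ᵥ star ((Tᴴ * T) *ᵥ w) := by
    rw [power, ofReal_sum_norm_sq, ← Matrix.mulVec_mulVec, Matrix.star_mulVec _ (T *ᵥ w),
      Matrix.conjTranspose_conjTranspose, dotProduct_comm, dotProduct_comm w,
      ← Matrix.dotProduct_mulVec]
  have := (h _ P).trans (by rw [hP', hP, ← hU, ← h])
  exact_mod_cast this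

end perpProj

/-! ### The residual of the observation -/

variable {N M : ℕ}

/-- With zero observation and zero noise level the residual test holds for every positive threshold,
so only the rank condition of `JointlyTypical` remains. -/
lemma measurableSet_rank_columns (J : Finset (Fin M)) :
    MeasurableSet {A : Fin N → Fin M → ℂ | (columns A J).rank = J.card} := by
  have h : {A : Fin N → Fin M → ℂ | (columns A J).rank = J.card} =
      ⋃ n : ℕ, (fun A => (A, (0 : Fin N → ℂ))) ⁻¹'
        {p | JointlyTypical J.card 0 (n + 1) p.1 p.2 J} := by
    ext A
    simp only [Set.mem_ofPred_eq, Set.mem_iUnion, Set.mem_preimage, JointlyTypical]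
    refine ⟨fun h => ⟨0, trivial, h, ?_⟩, fun ⟨_, _, h, _⟩ => h⟩
    simp [power]
  rw [h]
  exact .iUnion fun n => (measurableSet_jointlyTypical _ _ _ J).preimage (by fun_prop)

lemma measurable_power_perpProj_mulVec (J : Finset (Fin M)) :
    Measurable fun p : (Fin N → Fin M → ℂ) × (Fin N → ℂ) =>
      power (perpProj (columns p.1 J) *ᵥ p.2) := by
  have hC : Continuous fun p : (Fin N → Fin M → ℂ) × (Fin N → ℂ) => columns p.1 J :=
    continuous_pi fun i => continuous_pi fun j => by
      change Continuous fun p : (Fin N → Fin M → ℂ) × (Fin N → ℂ) => p.1 i j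
      fun_prop
  have hG := hC.matrix_conjTranspose.matrix_mul hC
  have hinv : ∀ a b, Measurable fun p : (Fin N → Fin M → ℂ) × (Fin N → ℂ) =>
      (((columns p.1 J)ᴴ * columns p.1 J)⁻¹) a b := by
    intro a b
    simp only [Matrix.inv_def, Matrix.smul_apply, smul_eq_mul, Ring.inverse_eq_inv']
    exact hG.matrix_det.measurable.inv.mul (hG.matrix_adjugate.matrix_elem a b).measurable
  have hP : ∀ i k, Measurable fun p : (Fin N → Fin M → ℂ) × (Fin N → ℂ) =>
      perpProj (columns p.1 J) i k := by
    intro i k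
    simp only [perpProj, Matrix.sub_apply, Matrix.mul_apply]
    refine measurable_const.sub (Finset.measurable_sum _ fun j _ => Measurable.mul ?_
      (hC.matrix_conjTranspose.matrix_elem j k).measurable)
    exact Finset.measurable_sum _ fun l _ => (hC.matrix_elem i l).measurable.mul (hinv l j)
  simp only [power, Matrix.mulVec, dotProduct]
  exact Finset.measurable_sum _ fun i _ => ((Finset.measurable_sum _ fun k _ =>
    (hP i k).mul ((measurable_pi_apply k).comp measurable_snd)).norm.pow_const 2)

/-- The part of the signal `x` outside the index set `J`. -/
def restrictCompl (J : Finset (Fin M)) (x : Fin M → ℂ) : Fin M → ℂ :=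
  fun j => if j ∈ J then 0 else x j

/-- Separates the randomness: the projection depends on `A` alone, the vector it acts on only on
`A'` and the noise. -/
lemma perpProj_mulVec_mixColumns {J : Finset (Fin M)} (A A' : Fin N → Fin M → ℂ)
    (x : Fin M → ℂ) (n : Fin N → ℂ) (hA : (columns A J).rank = J.card) :
    perpProj (columns A J) *ᵥ (Matrix.of (mixColumns J (A, A')) *ᵥ x + n) =
      perpProj (columns A J) *ᵥ (Matrix.of A' *ᵥ restrictCompl J x + n) := by
  have h : Matrix.of (mixColumns J (A, A')) *ᵥ x =
      columns A J *ᵥ (fun j => x j) + Matrix.of A' *ᵥ restrictCompl J x := by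
    ext i
    simp only [Matrix.mulVec, dotProduct, Pi.add_apply, Matrix.of_apply, mixColumns, columns,
      restrictCompl]
    rw [Finset.sum_coe_sort J (fun j => A i j * x j), ← Finset.sum_ite_mem_eq J,
      ← Finset.sum_add_distrib]
    refine Finset.sum_congr rfl fun j _ => ?_
    split_ifs <;> simp
  rw [h, add_assoc, Matrix.mulVec_add _ (columns A J *ᵥ _), Matrix.mulVec_mulVec,
    perpProj_mul_self (by simpa using hA), Matrix.zero_mulVec, zero_add]

lemma measurable_mulVec {m : ℕ} (U : Matrix (Fin m) (Fin N) ℂ) : Measurable fun w => U *ᵥ w := by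
  unfold Matrix.mulVec dotProduct
  fun_prop

lemma measurable_observation (x : Fin M → ℂ) :
    Measurable fun p : (Fin N → Fin M → ℂ) × (Fin N → ℂ) => Matrix.of p.1 *ᵥ x + p.2 := by
  refine measurable_pi_lambda _ fun i => Measurable.add ?_ (by fun_prop)
  simp only [Matrix.mulVec, dotProduct, Matrix.of_apply]
  fun_prop

lemma measurableSet_residual (x : Fin M → ℂ) (J : Finset (Fin M)) {T : Set ℝ}
    (hT : MeasurableSet T) :
    MeasurableSet {p : (Fin N → Fin M → ℂ) × (Fin N → ℂ) | (columns p.1 J).rank = J.card ∧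
      power (perpProj (columns p.1 J) *ᵥ (Matrix.of p.1 *ᵥ x + p.2)) ∈ T} :=
  ((measurableSet_rank_columns J).preimage measurable_fst).inter
    (((measurable_power_perpProj_mulVec J).comp
      (measurable_fst.prodMk (measurable_observation x))) hT)

/-- The power of the residual of the observation with respect to the columns in `J` behaves like
that of a complex Gaussian vector of length `N - |J|`, the variance being that of the noise together
with the part of the signal outside `J`. -/
lemma measure_residual_le (ρ : Measure (Fin N → ℂ)) [IsProbabilityMeasure ρ] (x : Fin M → ℂ)
    (J : Finset (Fin M)) {v : ℝ≥0}
    (hρ : ((matrixLaw N M).prod ρ).map (fun p => Matrix.of p.1 *ᵥ restrictCompl J x + p.2) =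
      Measure.pi fun _ => complexGaussian v)
    {T : Set ℝ} (hT : MeasurableSet T) {K : ℝ≥0∞}
    (hK : (Measure.pi fun _ : Fin (N - J.card) => complexGaussian v) {w | power w ∈ T} ≤ K) :
    ((matrixLaw N M).prod ρ) {p | (columns p.1 J).rank = J.card ∧
      power (perpProj (columns p.1 J) *ᵥ (Matrix.of p.1 *ᵥ x + p.2)) ∈ T} ≤ K := by
  have hE := measurableSet_residual (N := N) x J hT
  set E := {p : (Fin N → Fin M → ℂ) × (Fin N → ℂ) | (columns p.1 J).rank = J.card ∧
      power (perpProj (columns p.1 J) *ᵥ (Matrix.of p.1 *ᵥ x + p.2)) ∈ T} with hEdef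
  -- Draw `(A, A', n)` independently and use the mixed matrix. By Fubini it suffices to bound the
  -- probability over `(A', n)` for each fixed `A`.
  have hΦ := ((measurePreserving_mixColumns (N := N) J).prod (MeasurePreserving.id ρ)).comp
    (measurePreserving_prodAssoc (matrixLaw N M) (matrixLaw N M) ρ).symm
  rw [← hΦ.measure_preimage hE.nullMeasurableSet,
    Measure.prod_apply (hΦ.measurable hE)]
  refine (lintegral_mono (g := fun _ => K) fun A => ?_).trans (by simp)
  by_cases hA : (columns A J).rank = J.card
  swap
  · have : (Prod.mk A ⁻¹' ((Prod.map (mixColumns J) id ∘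
        MeasurableEquiv.prodAssoc.symm) ⁻¹' E)) = ∅ := by
      ext p
      simp only [Set.mem_preimage, hEdef, Set.mem_ofPred_eq, Set.mem_empty_iff_false, iff_false]
      intro h
      apply hA
      rw [← h.1]
      congr 1
      ext i j
      simp [columns, mixColumns, MeasurableEquiv.prodAssoc]
    rw [this]
    simp
  have hA' : (columns A J).rank = Fintype.card J := by simpa using hA
  obtain ⟨U, hU, hU'⟩ := exists_conjTranspose_mul_eq_perpProj hA' (Fintype.card_coe J)
  -- For fixed `A` the matrix `U` is deterministic with orthonormal rows, so it sends the Gaussian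
  -- vector to a shorter one with the same variance per coordinate.
  have hlaw : ((matrixLaw N M).prod ρ).map
      (fun p => U *ᵥ (Matrix.of p.1 *ᵥ restrictCompl J x + p.2)) =
      Measure.pi fun _ => complexGaussian v := by
    have h1 := map_mulVec_pi_complexGaussian U 1 v (by simpa using hU)
    rw [← hρ, Measure.map_map (measurable_mulVec U) (measurable_observation _), one_mul] at h1
    exact h1
  rw [← hlaw] at hK
  refine le_trans ?_ ((Measure.le_map_apply ((measurable_mulVec U).comp
    (measurable_observation _)).aemeasurable _).trans hK)
  refine measure_mono fun p hp => ?_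
  have hcol : columns (mixColumns J (A, p.1)) J = columns A J := by
    ext i j
    simp [columns, mixColumns]
  have hp2 : power (perpProj (columns (mixColumns J (A, p.1)) J) *ᵥ
      (Matrix.of (mixColumns J (A, p.1)) *ᵥ x + p.2)) ∈ T := hp.2
  rw [hcol, perpProj_mulVec_mixColumns A p.1 x p.2 hA, power_eq_of_conjTranspose_mul
    (perpProj_mul_perpProj hA') conjTranspose_perpProj hU'] at hp2
  exact hp2

/-! ### Full column rank -/

lemma complexGaussian_singleton_zero {v : ℝ≥0} (hv : v ≠ 0) : complexGaussian v {0} = 0 := by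
  have := nullSingletonClass_gaussianReal (μ := 0) (v := v / 2) (by simpa using hv)
  rw [complexGaussian, Measure.map_apply (by fun_prop) (measurableSet_singleton _)]
  refine measure_mono_null (t := {0} ×ˢ Set.univ) (fun p hp => ?_) (by simp)
  have := congrArg Complex.re (hp : (p.1 : ℂ) + (p.2 : ℂ) * Complex.I = 0)
  simpa using this

lemma measure_power_eq_zero {q : ℕ} (hq : 0 < q) {v : ℝ≥0} (hv : v ≠ 0) :
    (Measure.pi fun _ : Fin q => complexGaussian v) {w | power w ∈ ({0} : Set ℝ)} = 0 := by
  have h := (measurePreserving_eval (fun _ : Fin q => complexGaussian v) ⟨0, hq⟩).measure_preimage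
    (measurableSet_singleton 0).nullMeasurableSet
  rw [complexGaussian_singleton_zero hv] at h
  refine measure_mono_null (fun w hw => ?_) h
  have := (Finset.sum_eq_zero_iff_of_nonneg fun i _ => by positivity).1 (hw : ∑ i, ‖w i‖ ^ 2 = 0)
  simpa using this ⟨0, hq⟩ (Finset.mem_univ _)

lemma rank_columns_eq_card_iff (A : Fin N → Fin M → ℂ) (J : Finset (Fin M)) :
    (columns A J).rank = J.card ↔ LinearIndepOn ℂ (fun j i => A i j) (J : Set (Fin M)) := by
  have h : LinearIndepOn ℂ (fun j i => A i j) (J : Set (Fin M)) ↔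
      LinearIndependent ℂ (columns A J).col := Iff.rfl
  rw [h, linearIndependent_iff_card_eq_finrank_span, Set.finrank,
    ← Matrix.rank_eq_finrank_span_cols, Fintype.card_coe, eq_comm]

lemma rank_columns_insert {A : Fin N → Fin M → ℂ} {J : Finset (Fin M)} {j : Fin M} (hj : j ∉ J)
    (hA : (columns A J).rank = J.card)
    (h : power (perpProj (columns A J) *ᵥ (Matrix.of A *ᵥ Pi.single j 1)) ≠ 0) :
    (columns A (insert j J)).rank = (insert j J).card := by
  rw [rank_columns_eq_card_iff] at hA ⊢
  rw [Finset.coe_insert, linearIndepOn_insert (by simpa using hj)]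
  refine ⟨hA, fun hmem => h ?_⟩
  have himg : (fun j i => A i j) '' (J : Set (Fin M)) = Set.range (columns A J).col := by
    rw [Set.image_eq_range]
    rfl
  rw [himg, ← Matrix.range_mulVecLin] at hmem
  obtain ⟨z, hz⟩ := hmem
  have : Matrix.of A *ᵥ Pi.single j 1 = columns A J *ᵥ z := by
    rw [← Matrix.mulVecLin_apply (columns A J), hz]
    ext i
    simp
  rw [this, Matrix.mulVec_mulVec, perpProj_mul_self
    (by simpa using (rank_columns_eq_card_iff A J).2 hA)]
  simp [power]

/-- Columns are added one at a time: a new column almost surely has a nonzero residual modulo the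
earlier ones, hence is independent of them. -/
lemma ae_rank_columns (J : Finset (Fin M)) (hJ : J.card ≤ N) :
    ∀ᵐ A ∂(matrixLaw N M), (columns A J).rank = J.card := by
  induction J using Finset.induction with
  | empty =>
    refine .of_forall fun A => ?_
    have := (columns A ∅).rank_le_card_width
    simpa using this
  | insert j J hj ih =>
    rw [Finset.card_insert_of_notMem hj] at hJ
    -- With no noise and the signal `Pi.single j 1`, the observation is the new column itself. Its
    -- residual lives in dimension `N - J.card`, positive because `insert j J` has at most `N`
    -- elements.
    have h0 := measure_residual_le (Measure.dirac (0 : Fin N → ℂ)) (Pi.single j (1 : ℂ)) J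
      (v := 1) (by
        have hx : restrictCompl J (Pi.single j (1 : ℂ)) = Pi.single j 1 := by
          ext k
          by_cases hk : k ∈ J
          · simp [restrictCompl, hk, ne_of_mem_of_not_mem hk hj]
          · simp [restrictCompl, hk]
        have hs : ∑ i, ‖(Pi.single j 1 : Fin M → ℂ) i‖₊ ^ 2 = 1 := by
          rw [Finset.sum_eq_single j (fun k _ hk => by simp [hk]) (by simp)]
          simp
        have := map_mulVec_matrixLaw (N := N) (Pi.single j 1 : Fin M → ℂ)
        rw [hs] at this
        rw [hx, Measure.prod_dirac, Measure.map_map (measurable_observation _) (by fun_prop),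
          ← this]
        congr 1
        ext A
        simp)
      (measurableSet_singleton 0) (measure_power_eq_zero (by omega) one_ne_zero).le
    rw [Measure.prod_dirac, nonpos_iff_eq_zero, Measure.map_apply (by fun_prop)
      (measurableSet_residual _ _ (measurableSet_singleton 0))] at h0
    filter_upwards [ih (by omega), measure_eq_zero_iff_ae_notMem.1 h0] with A hA hA'
    refine rank_columns_insert hj hA fun hp => hA' ⟨hA, ?_⟩
    simpa using hp

/-! ### The error probability of a joint-typicality decoder -/

section

lemma map_observation (ν : ℝ) (x : Fin M → ℂ) :
    ((matrixLaw N M).prod (noiseLaw N ν)).map (fun p => Matrix.of p.1 *ᵥ x + p.2) =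
      Measure.pi fun _ => complexGaussian (∑ i, ‖x i‖₊ ^ 2 + Real.toNNReal (ν ^ 2)) := by
  have hf : Measurable fun A : Fin N → Fin M → ℂ => Matrix.of A *ᵥ x := by
    have := (measurable_observation (N := N) x).comp (measurable_id.prodMk measurable_const)
      (g := fun p => _) (f := fun A => (A, (0 : Fin N → ℂ)))
    simpa [Function.comp_def] using this
  rw [← map_add_pi_complexGaussian, ← map_mulVec_matrixLaw x]
  rw [← Measure.map_id (μ := Measure.pi fun _ : Fin N =>
    complexGaussian (Real.toNNReal (ν ^ 2)))]
  rw [Measure.map_prod_map _ _ hf measurable_id, Measure.map_map (by fun_prop)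
    (hf.prodMap measurable_id)]
  rfl

/-- The pairs of measurement matrix and noise for which the decoder fails. -/
def errorEvent (α : ℝ) (D : Decoder N M) (x : Fin M → ℂ) :
    Set ((Fin N → Fin M → ℂ) × (Fin N → ℂ)) :=
  {p | ¬ Recovers α x (D p.1 (Matrix.of p.1 *ᵥ x + p.2))}

variable {L : ℕ} {α ν c δ : ℝ} {D : Decoder N M}

lemma measurableSet_errorEvent (hD : IsJointTypicalityDecoder L ν δ D) (x : Fin M → ℂ) :
    MeasurableSet (errorEvent α D x) := by
  have h : errorEvent α D x = ⋃ J ∈ {J : Finset (Fin M) | ¬ Recovers α x J},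
      (fun p : (Fin N → Fin M → ℂ) × (Fin N → ℂ) => (p.1, Matrix.of p.1 *ᵥ x + p.2)) ⁻¹'
        {p | D p.1 p.2 = J} := by
    ext p
    simp [errorEvent]
  rw [h]
  exact .biUnion (Set.to_countable _) fun J _ =>
    (hD.measurable J).preimage (measurable_fst.prodMk (measurable_observation x))

lemma avgErrProb_eq (hD : IsJointTypicalityDecoder L ν δ D) (x : Fin M → ℂ) :
    avgErrProb α ν D x = ((matrixLaw N M).prod (noiseLaw N ν)) (errorEvent α D x) :=
  (Measure.prod_apply (measurableSet_errorEvent hD x)).symm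

lemma measurable_errProb (hD : IsJointTypicalityDecoder L ν δ D) (x : Fin M → ℂ) :
    Measurable (errProb α ν D x) :=
  measurable_measure_prodMk_left (measurableSet_errorEvent hD x)

/-- The power of the missed part of the signal, for an index set that does not recover it. -/
lemma le_sum_restrictCompl_of_not_recovers {x : Fin M → ℂ}
    (hc : 0 < c) (hx : (supp x).card = L) (hmin : (L : ℝ) * minMod x ^ 2 = c)
    {J : Finset (Fin M)} (hJ : ¬ Recovers α x J) :
    α * c ≤ ∑ j, ‖restrictCompl J x j‖ ^ 2 := by
  have hL : (0 : ℝ) < L := by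
    refine (Nat.cast_nonneg L).lt_of_ne fun h => ?_
    rw [← h, zero_mul] at hmin
    exact hc.ne hmin
  have hmin0 : 0 ≤ minMod x := Real.iInf_nonneg fun _ => norm_nonneg _
  have hle : ∀ i ∈ supp x, minMod x ≤ ‖x i‖ := fun i hi =>
    ciInf_le (f := fun i : supp x => ‖x i‖) ⟨0, by rintro _ ⟨_, rfl⟩; exact norm_nonneg _⟩ ⟨i, hi⟩
  have hcard : α * L ≤ ((supp x \ J).card : ℝ) := by
    have h1 : ((J ∩ supp x).card : ℝ) ≤ (1 - α) * L := by
      rwa [Recovers, gt_iff_lt, not_lt, hx, div_le_iff₀ hL] at hJ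
    have h2 := Finset.card_sdiff_add_card_inter (supp x) J
    rw [Finset.inter_comm, hx] at h2
    have h3 : ((supp x \ J).card : ℝ) + (J ∩ supp x).card = L := by exact_mod_cast h2
    linarith
  calc α * c = α * L * minMod x ^ 2 := by rw [← hmin]; ring
    _ ≤ (supp x \ J).card * minMod x ^ 2 := by gcongr
    _ = ∑ j ∈ supp x \ J, minMod x ^ 2 := by simp
    _ ≤ ∑ j ∈ supp x \ J, ‖restrictCompl J x j‖ ^ 2 := by
        refine Finset.sum_le_sum fun j hj => ?_
        rw [Finset.mem_sdiff] at hj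
        rw [restrictCompl, if_neg hj.2]
        have := hle j hj.1
        gcongr
    _ ≤ _ := Finset.sum_le_univ_sum_of_nonneg fun _ => by positivity

/-- The true variance is at least `ν ^ 2 + α c`, and enlarging the variance only makes a small
residual less likely. -/
lemma measure_residual_of_not_recovers {x : Fin M → ℂ} (hν : 0 < ν)
    (hc : 0 < c) (hx : (supp x).card = L) (hmin : (L : ℝ) * minMod x ^ 2 = c)
    {J : Finset (Fin M)} (hJ : ¬ Recovers α x J) {θ : ℝ} (h0 : 0 < θ) (h1 : θ < 1) :
    ((matrixLaw N M).prod (noiseLaw N ν)) {p | (columns p.1 J).rank = J.card ∧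
      power (perpProj (columns p.1 J) *ᵥ (Matrix.of p.1 *ᵥ x + p.2)) ∈
        Set.Iic ((N - J.card : ℕ) * θ * (ν ^ 2 + α * c))} ≤
      ENNReal.ofReal (Real.exp (-((N - J.card : ℕ) * expRate θ))) := by
  refine measure_residual_le _ x J (map_observation ν _) measurableSet_Iic ?_
  have hE := le_sum_restrictCompl_of_not_recovers hc hx hmin hJ
  have hν2 : 0 < Real.toNNReal (ν ^ 2) := Real.toNNReal_pos.2 (by positivity)
  refine measure_power_tail (by positivity) h0 fun w hw => ?_
  refine mul_le_mul_of_nonpos_left (le_trans (hw : _ ≤ _) ?_) ?_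
  · push_cast
    rw [Real.coe_toNNReal _ (by positivity)]
    gcongr _ * ?_
    linarith
  · have := (one_lt_inv₀ h0).2 h1
    linarith

lemma measure_residual_supp {x : Fin M → ℂ} (hν : 0 < ν) {θ : ℝ} (h0 : 0 < θ) {T : Set ℝ}
    (hTm : MeasurableSet T)
    (hT : ∀ t ∈ T, (1 - θ⁻¹) * ((N - (supp x).card : ℕ) * θ * ν ^ 2) ≤ (1 - θ⁻¹) * t) :
    ((matrixLaw N M).prod (noiseLaw N ν)) {p | (columns p.1 (supp x)).rank = (supp x).card ∧
      power (perpProj (columns p.1 (supp x)) *ᵥ (Matrix.of p.1 *ᵥ x + p.2)) ∈ T} ≤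
      ENNReal.ofReal (Real.exp (-((N - (supp x).card : ℕ) * expRate θ))) := by
  refine measure_residual_le _ x (supp x) (map_observation ν _) hTm ?_
  have h : restrictCompl (supp x) x = 0 := by
    ext j
    simp [restrictCompl, supp]
  have hν2 : 0 < Real.toNNReal (ν ^ 2) := Real.toNNReal_pos.2 (by positivity)
  refine measure_power_tail (by positivity) h0 fun w hw => ?_
  simpa [h, Real.coe_toNNReal _ (sq_nonneg ν)] using hT _ hw

/-- The threshold of the decoder. -/
noncomputable def threshold (α ν c : ℝ) : ℝ := min (α * c / 4) (ν ^ 2 / 2)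

/-- The exponential rate, in the number `N - L` of excess measurements. -/
noncomputable def errorRate (α ν c : ℝ) : ℝ :=
  min (expRate ((ν ^ 2 + α * c / 2) / (ν ^ 2 + α * c)))
    (min (expRate (1 - threshold α ν c / ν ^ 2)) (expRate (1 + threshold α ν c / ν ^ 2)))

lemma threshold_pos (hα : 0 < α) (hν : 0 < ν) (hc : 0 < c) : 0 < threshold α ν c :=
  lt_min (by positivity) (by positivity)

/-- The cap `ν ^ 2 / 2` in `threshold` serves to keep the lower-tail parameter `1 - threshold α ν c
/ ν ^ 2` positive. -/
lemma threshold_div_le (hν : 0 < ν) : threshold α ν c / ν ^ 2 ≤ 1 / 2 := by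
  rw [div_le_iff₀ (by positivity)]
  linarith [min_le_right (α * c / 4) (ν ^ 2 / 2), threshold.eq_def α ν c]

lemma errorRate_pos (hα : 0 < α) (hν : 0 < ν) (hc : 0 < c) : 0 < errorRate α ν c := by
  have h1 := threshold_div_le (α := α) (c := c) hν
  have h2 : 0 < threshold α ν c / ν ^ 2 := div_pos (threshold_pos hα hν hc) (by positivity)
  have h3 : 0 < α * c := by positivity
  refine lt_min (expRate_pos (by positivity) ?_)
    (lt_min (expRate_pos (by linarith) (by linarith)) (expRate_pos (by linarith) (by linarith)))
  rw [Ne, div_eq_one_iff_eq (by positivity)]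
  linarith

lemma exp_neg_mul_le {q : ℕ} {a b : ℝ} (h : a ≤ b) :
    ENNReal.ofReal (Real.exp (-(q * b))) ≤ ENNReal.ofReal (Real.exp (-(q * a))) := by
  gcongr

lemma errorEvent_subset {x : Fin M → ℂ} (hα : 0 < α) (hν : 0 < ν) (hc : 0 < c)
    (hx : (supp x).card = L) (hL : 0 < L) (hN : 2 * L ≤ N)
    (hD : IsJointTypicalityDecoder L ν (threshold α ν c) D) :
    errorEvent α D x ⊆
      {p | ¬ (columns p.1 (supp x)).rank = (supp x).card} ∪
      ({p | (columns p.1 (supp x)).rank = (supp x).card ∧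
          power (perpProj (columns p.1 (supp x)) *ᵥ (Matrix.of p.1 *ᵥ x + p.2)) ∈
            Set.Iic ((N - L : ℕ) * (1 - threshold α ν c / ν ^ 2) * ν ^ 2)} ∪
        {p | (columns p.1 (supp x)).rank = (supp x).card ∧
          power (perpProj (columns p.1 (supp x)) *ᵥ (Matrix.of p.1 *ᵥ x + p.2)) ∈
            Set.Ici ((N - L : ℕ) * (1 + threshold α ν c / ν ^ 2) * ν ^ 2)}) ∪
      ⋃ J ∈ {J : Finset (Fin M) | J.card = L ∧ ¬ Recovers α x J},
        {p | (columns p.1 J).rank = J.card ∧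
          power (perpProj (columns p.1 J) *ᵥ (Matrix.of p.1 *ᵥ x + p.2)) ∈
            Set.Iic ((N - J.card : ℕ) * ((ν ^ 2 + α * c / 2) / (ν ^ 2 + α * c)) *
              (ν ^ 2 + α * c))} := by
  intro p hp
  have hN0 : (0 : ℝ) < N := by
    have : 0 < N := by omega
    exact_mod_cast this
  have hq : ((N - L : ℕ) : ℝ) = N - L := by rw [Nat.cast_sub (by omega)]
  have hN2 : 2 * (L : ℝ) ≤ N := by exact_mod_cast hN
  have hL0 : (0 : ℝ) < L := by exact_mod_cast hL
  have hδ := threshold_pos hα hν hc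
  have hαc : 0 < α * c := by positivity
  by_cases htyp : JointlyTypical L ν (threshold α ν c) p.1 (Matrix.of p.1 *ᵥ x + p.2) (supp x)
  · obtain ⟨hcard, hrank, hlt⟩ := hD.typical _ _ ⟨_, htyp⟩
    refine Or.inr (Set.mem_biUnion (x := D p.1 (Matrix.of p.1 *ᵥ x + p.2)) ⟨hcard, hp⟩
      ⟨by rw [hrank, hcard], ?_⟩)
    have h1 := (abs_lt.1 hlt).2
    rw [sub_lt_iff_lt_add, one_div_mul_eq_div, div_lt_iff₀ hN0] at h1
    rw [hcard, hq, Set.mem_Iic]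
    refine h1.le.trans ?_
    have h2 : threshold α ν c ≤ α * c / 4 := min_le_left _ _
    have e1 : (threshold α ν c + ((N : ℝ) - L) / N * ν ^ 2) * N =
        threshold α ν c * N + (N - L) * ν ^ 2 := by
      field_simp
    have e2 : ((N : ℝ) - L) * ((ν ^ 2 + α * c / 2) / (ν ^ 2 + α * c)) * (ν ^ 2 + α * c) =
        (N - L) * (ν ^ 2 + α * c / 2) := by
      field_simp
    rw [e1, e2]
    -- Since `N ≤ 2 (N - L)`, the term `threshold * N` is at most `(N - L) α c / 2`; this is where
    -- the `4` in `threshold` comes from.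
    nlinarith
  · left
    by_cases hr : (columns p.1 (supp x)).rank = (supp x).card
    swap
    · exact Or.inl hr
    have h1 : threshold α ν c ≤ |1 / (N : ℝ) * power (perpProj (columns p.1 (supp x)) *ᵥ
        (Matrix.of p.1 *ᵥ x + p.2)) - ((N : ℝ) - L) / N * ν ^ 2| := by
      by_contra h
      exact htyp ⟨hx, by rw [hr, hx], not_le.1 h⟩
    set G := power (perpProj (columns p.1 (supp x)) *ᵥ (Matrix.of p.1 *ᵥ x + p.2)) with hG
    have e : 1 / (N : ℝ) * G - ((N : ℝ) - L) / N * ν ^ 2 = (G - (N - L) * ν ^ 2) / N := by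
      field_simp
    rw [e] at h1
    right
    rcases le_abs'.1 h1 with h | h
    -- The deviation is normalised by `N`, so it is at least `threshold * N`, which dominates the
    -- required `threshold * (N - L)`.
    · refine Or.inl ⟨hr, ?_⟩
      rw [Set.mem_Iic, hq, ← hG]
      rw [div_le_iff₀ hN0] at h
      have e2 : ((N : ℝ) - L) * (1 - threshold α ν c / ν ^ 2) * ν ^ 2 =
        (N - L) * (ν ^ 2 - threshold α ν c) := by field_simp
      rw [e2]
      nlinarith
    · refine Or.inr ⟨hr, ?_⟩
      rw [Set.mem_Ici, hq, ← hG]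
      rw [le_div_iff₀ hN0] at h
      have e2 : ((N : ℝ) - L) * (1 + threshold α ν c / ν ^ 2) * ν ^ 2 =
        (N - L) * (ν ^ 2 + threshold α ν c) := by field_simp
      rw [e2]
      nlinarith

/-- The average error probability decays exponentially in the number of excess measurements, up to
the number of index sets. -/
lemma avgErrProb_le {x : Fin M → ℂ} (hα : 0 < α) (hν : 0 < ν) (hc : 0 < c)
    (hx : (supp x).card = L) (hmin : (L : ℝ) * minMod x ^ 2 = c) (hN : 2 * L ≤ N)
    (hD : IsJointTypicalityDecoder L ν (threshold α ν c) D) :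
    avgErrProb α ν D x ≤
      (2 ^ M + 2) * ENNReal.ofReal (Real.exp (-((N - L : ℕ) * errorRate α ν c))) := by
  classical
  have hL : 0 < L := by
    rcases Nat.eq_zero_or_pos L with rfl | h
    · simp at hmin; linarith
    · exact h
  have hαc : 0 < α * c := by positivity
  have hδ1 := threshold_div_le (α := α) (c := c) hν
  have hδ2 : 0 < threshold α ν c / ν ^ 2 := div_pos (threshold_pos hα hν hc) (by positivity)
  set K := ENNReal.ofReal (Real.exp (-((N - L : ℕ) * errorRate α ν c))) with hK
  set P := (matrixLaw N M).prod (noiseLaw N ν) with hP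
  have b0 : P {p | ¬ (columns p.1 (supp x)).rank = (supp x).card} = 0 := by
    have h := ae_rank_columns (N := N) (supp x) (by omega)
    exact (Measure.quasiMeasurePreserving_fst (μ := matrixLaw N M) (ν := noiseLaw N ν)).ae h
  have b1 := measure_residual_supp (N := N) (x := x) hν
    (θ := 1 - threshold α ν c / ν ^ 2) (by linarith)
    (T := Set.Iic ((N - L : ℕ) * (1 - threshold α ν c / ν ^ 2) * ν ^ 2)) measurableSet_Iic
    (fun t ht => mul_le_mul_of_nonpos_left (by rw [hx]; exact ht) (by
      have := (one_lt_inv₀ (a := 1 - threshold α ν c / ν ^ 2) (by linarith)).2 (by linarith)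
      linarith))
  have b2 := measure_residual_supp (N := N) (x := x) hν
    (θ := 1 + threshold α ν c / ν ^ 2) (by linarith)
    (T := Set.Ici ((N - L : ℕ) * (1 + threshold α ν c / ν ^ 2) * ν ^ 2)) measurableSet_Ici
    (fun t ht => mul_le_mul_of_nonneg_left (by rw [hx]; exact ht) (by
      have := (inv_lt_one₀ (a := 1 + threshold α ν c / ν ^ 2) (by linarith)).2 (by linarith)
      linarith))
  rw [hx] at b1 b2
  have b1' := b1.trans (exp_neg_mul_le (a := errorRate α ν c)
    ((min_le_right _ _).trans (min_le_left _ _)))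
  have b2' := b2.trans (exp_neg_mul_le (a := errorRate α ν c)
    ((min_le_right _ _).trans (min_le_right _ _)))
  rw [avgErrProb_eq hD]
  refine (measure_mono (errorEvent_subset hα hν hc hx hL hN hD)).trans ?_
  refine (measure_union_le _ _).trans ?_
  rw [add_comm (2 ^ M : ℝ≥0∞), add_mul]
  refine add_le_add ((measure_union_le _ _).trans ?_) ?_
  · rw [b0, zero_add, two_mul]
    refine (measure_union_le _ _).trans (add_le_add ?_ ?_)
    · rw [hx]; exact b1'
    · rw [hx]; exact b2'
  · set F : Finset (Finset (Fin M)) :=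
      Finset.univ.filter fun J => J.card = L ∧ ¬ Recovers α x J with hF
    have hF' : {J : Finset (Fin M) | J.card = L ∧ ¬ Recovers α x J} = (F : Set _) := by
      ext J; simp [hF]
    rw [hF']
    refine (measure_biUnion_finset_le F _).trans ?_
    refine (Finset.sum_le_card_nsmul F _ K fun J hJ => ?_).trans ?_
    · obtain ⟨hJL, hJr⟩ := (Finset.mem_filter.1 hJ).2
      have b3 := measure_residual_of_not_recovers (N := N) hν hc hx hmin hJr
        (θ := (ν ^ 2 + α * c / 2) / (ν ^ 2 + α * c)) (by positivity)
        (by rw [div_lt_one (by positivity)]; linarith)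
      refine b3.trans ?_
      rw [hJL]
      exact exp_neg_mul_le (min_le_left _ _)
    · rw [nsmul_eq_mul]
      gcongr
      have : F.card ≤ 2 ^ M := (Finset.card_le_univ F).trans (by simp)
      exact_mod_cast this

end

/-! ### Numerical estimates for the linear regime -/

lemma two_pow_add_two_mul_exp_le {M : ℕ} (hM : 1 ≤ M) {t : ℝ} (ht : 4 * M ≤ t) :
    (2 ^ M + 2) * ENNReal.ofReal (Real.exp (-t)) ≤ ENNReal.ofReal (Real.exp (-2 * M)) := by
  have h1 : (2 : ℝ) ≤ Real.exp 1 := by linarith [Real.add_one_le_exp 1]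
  have hM' : (1 : ℝ) ≤ M := by exact_mod_cast hM
  have h2 : (2 : ℝ) ≤ Real.exp M := h1.trans (Real.exp_le_exp.2 hM')
  have h3 : (2 : ℝ) ^ M ≤ Real.exp M := by
    rw [← mul_one (M : ℝ), Real.exp_nat_mul]
    gcongr
  have e : (2 ^ M + 2 : ℝ≥0∞) = ENNReal.ofReal (2 ^ M + 2) := by
    rw [ENNReal.ofReal_add (by positivity) (by positivity), ENNReal.ofReal_pow (by positivity)]
    simp
  rw [e, ← ENNReal.ofReal_mul (by positivity)]
  refine ENNReal.ofReal_le_ofReal ?_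
  -- Here `2 ^ M + 2 ≤ exp M + exp M ≤ exp M * exp M`, so half of the exponent `4 M` pays for the
  -- union bound.
  calc (2 ^ M + 2) * Real.exp (-t) ≤ (Real.exp M * Real.exp M) * Real.exp (-(4 * M)) := by
        gcongr
        nlinarith
    _ = Real.exp (-2 * M) := by
        rw [← Real.exp_add, ← Real.exp_add]
        ring_nf

/-- Rounding down costs at most `β` in `M ≤ β (L + 1)`, and `β ≤ M / 2`. -/
lemma le_two_mul_sparsity {β : ℝ} (hβ : 0 < β) {M : ℕ} (hM : 2 * β ≤ M) :
    (M : ℝ) ≤ 2 * β * sparsity β M := by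
  have h := (Nat.lt_floor_add_one (1 / β * (M : ℝ))).le
  rw [one_div_mul_eq_div, div_le_iff₀ hβ] at h
  have : (⌊(M : ℝ) / β⌋₊ : ℝ) = sparsity β M := by rw [sparsity, one_div_mul_eq_div]
  rw [this] at h
  linarith

end NoisyCS

theorem theorem3 (α β ν c : ℝ) (hα : α ∈ Set.Ioo (0 : ℝ) 1) (hβ : 2 < β) (hν : 0 < ν)
    (hc : 0 < c) :
    ∃ C₃ : ℝ, 1 < C₃ ∧ ∃ δ : ℝ, 0 < δ ∧ ∃ r : ℝ, 0 < r ∧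
      ∀ N : ℕ → ℕ, (∀ᶠ M in atTop, (N M : ℝ) > C₃ * (NoisyCS.sparsity β M : ℝ)) →
        (∃ D : ∀ M, NoisyCS.Decoder (N M) M,
          ∀ M, NoisyCS.IsJointTypicalityDecoder (NoisyCS.sparsity β M) ν δ (D M)) ∧
        ∀ D : ∀ M, NoisyCS.Decoder (N M) M,
          (∀ M, NoisyCS.IsJointTypicalityDecoder (NoisyCS.sparsity β M) ν δ (D M)) →
          ∀ (P : ℝ) (x : ∀ M : ℕ, Fin M → ℂ),
            (∀ M, (NoisyCS.supp (x M)).card = NoisyCS.sparsity β M) →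
            (∀ᶠ M in atTop, (NoisyCS.sparsity β M : ℝ) * NoisyCS.minMod (x M) ^ 2 = c) →
            (∀ᶠ M in atTop, NoisyCS.power (x M) = P) →
            Tendsto (fun M => NoisyCS.avgErrProb α ν (D M) (x M)) atTop (𝓝 0) ∧
            (∀ᶠ M : ℕ in atTop,
              NoisyCS.avgErrProb α ν (D M) (x M) ≤ ENNReal.ofReal (Real.exp (-r * M))) ∧
            ∀ ξ ∈ Set.Ioc (0 : ℝ) 1, ∀ᶠ M : ℕ in atTop,
              NoisyCS.matrixLaw (N M) M
                  {A | NoisyCS.errProb α ν (D M) (x M) A > ENNReal.ofReal ξ} ≤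
                ENNReal.ofReal (Real.exp (-r * M)) := by
  have hh := NoisyCS.errorRate_pos hα.1 hν hc
  have hβ0 : 0 < β := by linarith
  have hC : 0 < 8 * β / NoisyCS.errorRate α ν c := by positivity
  -- The `2` ensures `2 L ≤ N`; the other term makes `(N - L) * errorRate ≥ 8 β L ≥ 4 M`. The rate
  -- can then be `r = 1`.
  refine ⟨2 + 8 * β / NoisyCS.errorRate α ν c, by linarith, NoisyCS.threshold α ν c,
    NoisyCS.threshold_pos hα.1 hν hc, 1, one_pos, fun N hN => ⟨?_, ?_⟩⟩
  · choose D hD using fun M => NoisyCS.exists_isJointTypicalityDecoder (N M) M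
      (NoisyCS.sparsity β M) ν (NoisyCS.threshold α ν c)
    exact ⟨D, hD⟩
  intro D hD P x hx hmin _
  -- The rate `2` exceeds the claimed `1`, so that the spare factor `exp (-M)` can absorb `1 / ξ` in
  -- Markov's inequality.
  have key : ∀ᶠ M : ℕ in atTop,
      NoisyCS.avgErrProb α ν (D M) (x M) ≤ ENNReal.ofReal (Real.exp (-2 * M)) := by
    filter_upwards [hN, hmin, eventually_ge_atTop 1,
      tendsto_natCast_atTop_atTop.eventually_ge_atTop (2 * β)] with M hNM hminM hM hMβ
    have hS := NoisyCS.le_two_mul_sparsity hβ0 hMβ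
    set L := NoisyCS.sparsity β M
    have hL0 : (0 : ℝ) ≤ L := Nat.cast_nonneg L
    have h2 : 2 * L ≤ N M := by
      have : (2 * L : ℝ) ≤ N M := by nlinarith
      exact_mod_cast this
    refine (NoisyCS.avgErrProb_le hα.1 hν hc (hx M) hminM h2 (hD M)).trans
      (NoisyCS.two_pow_add_two_mul_exp_le hM ?_)
    rw [Nat.cast_sub (by omega)]
    have h3 : 8 * β / NoisyCS.errorRate α ν c * L ≤ N M - L := by nlinarith
    calc (4 * M : ℝ) ≤ 4 * (2 * β * L) := by gcongr
      _ = 8 * β / NoisyCS.errorRate α ν c * L * NoisyCS.errorRate α ν c := by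
        field_simp; ring
      _ ≤ _ := by gcongr
  have hlim (a : ℝ) (ha : a < 0) :
      Tendsto (fun M : ℕ => Real.exp (a * M)) atTop (𝓝 0) :=
    Real.tendsto_exp_atBot.comp
      (tendsto_natCast_atTop_atTop.const_mul_atTop_of_neg ha)
  refine ⟨?_, ?_, fun ξ hξ => ?_⟩
  · have h0 := ENNReal.tendsto_ofReal (hlim (-2) (by norm_num))
    rw [ENNReal.ofReal_zero] at h0
    exact tendsto_of_tendsto_of_tendsto_of_le_of_le' tendsto_const_nhds h0
      (.of_forall fun _ => bot_le) key
  · filter_upwards [key] with M hM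
    refine hM.trans (ENNReal.ofReal_le_ofReal (Real.exp_le_exp.2 ?_))
    have : (0 : ℝ) ≤ M := Nat.cast_nonneg M
    linarith
  · filter_upwards [key, (hlim (-1) (by norm_num)).eventually_le_const hξ.1] with M hM hMξ
    calc NoisyCS.matrixLaw (N M) M {A | NoisyCS.errProb α ν (D M) (x M) A > ENNReal.ofReal ξ}
        ≤ NoisyCS.matrixLaw (N M) M
            {A | ENNReal.ofReal ξ ≤ NoisyCS.errProb α ν (D M) (x M) A} :=
          measure_mono fun A hA => by
            rw [Set.mem_ofPred_eq] at hA ⊢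
            exact hA.le
      _ ≤ NoisyCS.avgErrProb α ν (D M) (x M) / ENNReal.ofReal ξ :=
          meas_ge_le_lintegral_div (NoisyCS.measurable_errProb (hD M) (x M)).aemeasurable
            (by simpa using hξ.1) ENNReal.ofReal_ne_top
      _ ≤ ENNReal.ofReal (Real.exp (-2 * M)) / ENNReal.ofReal ξ := by gcongr
      _ = ENNReal.ofReal (Real.exp (-2 * M) / ξ) := (ENNReal.ofReal_div_of_pos hξ.1).symm
      _ ≤ ENNReal.ofReal (Real.exp (-1 * M)) := by
          refine ENNReal.ofReal_le_ofReal ((div_le_iff₀ hξ.1).2 ?_)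
          calc Real.exp (-2 * M) = Real.exp (-1 * M) * Real.exp (-1 * M) := by
                rw [← Real.exp_add]; ring_nf
            _ ≤ _ := by gcongr
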